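/- Let $X=\{\Omega,\mathcal F,(\mathcal F_t)_{t\ge0},(X_t)_{t\ge 0},(\mathbb P_x)_{x\in\mathbb R^d}\}$ be a Feller process on $\mathbb R^d$, that is, a time-homogeneous Markov process with values in the one-point compactification $\mathbb R^d\cup\{\Delta\}$, with $\mathbb P_x(X_0=x)=1$, whose paths are $\mathbb P_x$-almost surely right continuous with left limits in $\mathbb R^d\cup\{\Delta\}$ for every $x\in\mathbb R^d$, and such that the operators $T_tu(x)=\mathbb E_x[u(X_t)]$ (with $u(\Delta)=0$) map the space $C_\infty(\mathbb R^d)$ of continuous functions vanishing at infinity into itself and satisfy $\|T_tu-u\|_\infty\to0$ as $t\downarrow 0$ for every $u\in C_\infty(\mathbb R^d)$. Let $(L,D(L))$ be its Feller generator: $D(L)$ is the set of $u\in C_\infty(\mathbb R^d)$ for which $Lu:=\lim_{t\downarrow0}(T_tu-u)/t$ exists in $(C_\infty(\mathbb R^d),\|\cdot\|_\infty)$. Suppose that $C_c^\infty(\mathbb R^d)\subset D(L)$ and that, for all $u\in C_c^\infty(\mathbb R^d)$ and $x\in\mathbb R^d$, $$Lu(x)=\int_{\mathbb R^d\setminus\{0\}}\bigl(u(x+z)-u(x)-\langle\nabla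 u(x),z\rangle\mathbf 1_{\{|z|<1\}}(z)\bigr)\,N(x,dz),$$ where for each $x$, $N(x,dz)$ is a non-negative measure on $\mathbb R^d\setminus\{0\}$ and $$\sup_{x\in\mathbb R^d}\int_{\mathbb R^d\setminus\{0\}}|z|^2\,N(x,dz)<\infty.$$ Then, for all $t>0$, $i=1,\dots,d$ and $x_0\in\mathbb R^d$: $X_t\in\mathbb R^d$ holds $\mathbb P_{x_0}$-almost surely, $X_t^{(i)}$ has finite second moment under $\mathbb P_{x_0}$, and $$\mathbb E_{x_0}\bigl[(X_t^{(i)}-x_0^{(i)})^2\bigr]=\mathbb E_{x_0}\Bigl[\int_0^t\Bigl(\int_{\mathbb R^d\setminus\{0\}}(z^{(i)})^2N(X_s,dz)\Bigr)ds\Bigr]+2\,\mathbb E_{x_0}\Bigl[\int_0^t(X_s^{(i)}-x_0^{(i)})\Bigl(\int_{\{|z|\ge1\}}z^{(i)}N(X_s,dz)\Bigr)ds\Bigr]<\infty,$$ $$\mathbb E_{x_0}\bigl[X_t^{(i)}-x_0^{(i)}\bigr]=\mathbb E_{x_0}\Bigl[\int_0^t\Bigl(\int_{\{|z|\ge1\}}z^{(i)}N(X_s,dz)\Bigr)ds\Bigr],$$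 where the integrands of the three time integrals on the right-hand sides are absolutely integrable with respect to $ds\otimes\mathbb P_{x_0}$ on $(0,t]\times\Omega$. -/

import Mathlib

open MeasureTheory Filter Topology
open scoped NNReal ENNReal ZeroAtInfty

noncomputable section

namespace FellerMoment

/-- The one-point compactification `ℝᵈ ∪ {Δ}`; the cemetery `Δ` is `OnePoint.infty`. -/
abbrev Compactified (d : ℕ) : Type := OnePoint (EuclideanSpace ℝ (Fin d))

instance instMeasurableSpaceCompactified (d : ℕ) : MeasurableSpace (Compactified d) :=
  borel (Compactified d)

instance instBorelSpaceCompactified (d : ℕ) : BorelSpace (Compactified d) := ⟨rfl⟩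

/-- The usual extension of a function on `ℝᵈ` to `ℝᵈ ∪ {Δ}` by `u(Δ) = 0`. -/
def extendZero {d : ℕ} (u : EuclideanSpace ℝ (Fin d) → ℝ) : Compactified d → ℝ :=
  fun p => OnePoint.elim p 0 u

/-- The point of `ℝᵈ` underlying a point of `ℝᵈ ∪ {Δ}`. The value at `Δ` is a placeholder. -/
def position {d : ℕ} : Compactified d → EuclideanSpace ℝ (Fin d) :=
  fun p => OnePoint.elim p 0 id

/-- `T_t u(x) = 𝔼_x[u(X_t)]`, with `u(Δ) = 0`. -/
def transition {d : ℕ} {Ω : Type*} [MeasurableSpace Ω] (X : ℝ≥0 → Ω → Compactified d)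
    (P : EuclideanSpace ℝ (Fin d) → Measure Ω) (t : ℝ≥0)
    (u : EuclideanSpace ℝ (Fin d) → ℝ) (x : EuclideanSpace ℝ (Fin d)) : ℝ :=
  ∫ ω, extendZero u (X t ω) ∂(P x)

/-- A Feller process on `ℝᵈ`. It is not assumed to be conservative: a path may be sent to `Δ`. -/
structure FellerProcess (d : ℕ) (Ω : Type*) [mΩ : MeasurableSpace Ω] where
  /-- the process -/
  X : ℝ≥0 → Ω → Compactified d
  /-- the filtration -/
  ℱ : Filtration ℝ≥0 mΩ
  /-- the law of the process started at a point of `ℝᵈ` -/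
  P : EuclideanSpace ℝ (Fin d) → Measure Ω
  isProbabilityMeasure : ∀ x, IsProbabilityMeasure (P x)
  adapted : ∀ t, Measurable[ℱ t] (X t)
  start : ∀ x : EuclideanSpace ℝ (Fin d), ∀ᵐ ω ∂(P x), X 0 ω = OnePoint.some x
  /-- time-homogeneous Markov property, for bounded Borel functions -/
  markov : ∀ (x : EuclideanSpace ℝ (Fin d)) (s t : ℝ≥0) (u : EuclideanSpace ℝ (Fin d) → ℝ),
    Measurable u → (∃ C : ℝ, ∀ y, |u y| ≤ C) →
    (P x)[fun ω => extendZero u (X (s + t) ω) | ℱ s]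
      =ᵐ[P x] fun ω => extendZero (transition X P t u) (X s ω)
  /-- Feller property: `T_t` maps `C_∞(ℝᵈ)` into itself -/
  feller : ∀ (t : ℝ≥0) (u : C₀(EuclideanSpace ℝ (Fin d), ℝ)),
    ∃ v : C₀(EuclideanSpace ℝ (Fin d), ℝ), ∀ x, v x = transition X P t u x
  /-- strong continuity: `T_t u → u` uniformly as `t ↓ 0` -/
  strongly_continuous : ∀ u : C₀(EuclideanSpace ℝ (Fin d), ℝ),
    TendstoUniformly (fun t : ℝ≥0 => transition X P t u) u (𝓝[>] 0)
  /-- almost surely the paths are right continuous with left limits in `ℝᵈ ∪ {Δ}` -/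
  cadlag : ∀ x, ∀ᵐ ω ∂(P x), ∀ t : ℝ≥0,
    ContinuousWithinAt (fun s => X s ω) (Set.Ici t) t ∧
      ∃ l : Compactified d, Tendsto (fun s => X s ω) (𝓝[<] t) (𝓝 l)

namespace FellerProcess

variable {d : ℕ} {Ω : Type*} [MeasurableSpace Ω]

/-- The Feller semigroup `(T_t)` acting on `C_∞(ℝᵈ)`. -/
def semigroup (𝕏 : FellerProcess d Ω) (t : ℝ≥0) (u : C₀(EuclideanSpace ℝ (Fin d), ℝ)) :
    C₀(EuclideanSpace ℝ (Fin d), ℝ) :=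
  Classical.choose (𝕏.feller t u)

theorem semigroup_apply (𝕏 : FellerProcess d Ω) (t : ℝ≥0)
    (u : C₀(EuclideanSpace ℝ (Fin d), ℝ)) (x : EuclideanSpace ℝ (Fin d)) :
    𝕏.semigroup t u x = ∫ ω, extendZero u (𝕏.X t ω) ∂(𝕏.P x) :=
  Classical.choose_spec (𝕏.feller t u) x

/-- `u ∈ D(L)` and `Lu = v`: `(T_t u - u) / t → v` in the sup norm as `t ↓ 0`. -/
def HasGenerator (𝕏 : FellerProcess d Ω) (u v : C₀(EuclideanSpace ℝ (Fin d), ℝ)) : Prop :=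
  Tendsto (fun t : ℝ≥0 => (t : ℝ)⁻¹ • (𝕏.semigroup t u - u)) (𝓝[>] 0) (𝓝 v)

/-- The domain `D(L)` of the Feller generator. -/
def generatorDomain (𝕏 : FellerProcess d Ω) : Set C₀(EuclideanSpace ℝ (Fin d), ℝ) :=
  {u | ∃ v, 𝕏.HasGenerator u v}

open Classical in
/-- The Feller generator `L` (only meaningful on `D(L)`). -/
def generator (𝕏 : FellerProcess d Ω) (u : C₀(EuclideanSpace ℝ (Fin d), ℝ)) :
    C₀(EuclideanSpace ℝ (Fin d), ℝ) :=
  if h : ∃ v, 𝕏.HasGenerator u v then Classical.choose h else 0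

/-- The coordinate `X_t^{(i)}`. -/
def coord (𝕏 : FellerProcess d Ω) (i : Fin d) (t : ℝ≥0) (ω : Ω) : ℝ :=
  position (𝕏.X t ω) i

end FellerProcess

/-- The pure-jump integro-differential expression
`∫_{ℝᵈ∖{0}} (u(x+z) - u(x) - ⟨∇u(x), z⟩ 1_{|z|<1}) N(x, dz)`. A measure on `ℝᵈ∖{0}` is given as a
measure on `ℝᵈ` of which only the restriction to `{0}ᶜ` is used. -/
def jumpOperator {d : ℕ} (N : EuclideanSpace ℝ (Fin d) → Measure (EuclideanSpace ℝ (Fin d)))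
    (u : EuclideanSpace ℝ (Fin d) → ℝ) (x : EuclideanSpace ℝ (Fin d)) : ℝ :=
  ∫ z in {0}ᶜ, (u (x + z) - u x -
    Set.indicator {z | ‖z‖ < 1} (fun z => (inner ℝ (gradient u x) z : ℝ)) z) ∂(N x)

/-- The generator of `𝕏` is of pure-jump type with jumping kernel `N`, whose second moment is
uniformly bounded. -/
structure IsPureJump {d : ℕ} {Ω : Type*} [MeasurableSpace Ω] (𝕏 : FellerProcess d Ω)
    (N : EuclideanSpace ℝ (Fin d) → Measure (EuclideanSpace ℝ (Fin d))) : Prop where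
  smooth_mem_domain : ∀ u : C₀(EuclideanSpace ℝ (Fin d), ℝ),
    ContDiff ℝ ((⊤ : ℕ∞) : WithTop ℕ∞) u → HasCompactSupport u → u ∈ 𝕏.generatorDomain
  generator_eq : ∀ u : C₀(EuclideanSpace ℝ (Fin d), ℝ),
    ContDiff ℝ ((⊤ : ℕ∞) : WithTop ℕ∞) u → HasCompactSupport u → ∀ x, 𝕏.generator u x = jumpOperator N u x
  second_moment : (⨆ x : EuclideanSpace ℝ (Fin d), ∫⁻ z in {0}ᶜ, ‖z‖ₑ ^ 2 ∂(N x)) < (⊤ : ℝ≥0∞)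

/-- `∫_{ℝᵈ∖{0}} (z^{(i)})² N(x, dz)`. -/
def jumpSecondMoment {d : ℕ} (N : EuclideanSpace ℝ (Fin d) → Measure (EuclideanSpace ℝ (Fin d)))
    (i : Fin d) (x : EuclideanSpace ℝ (Fin d)) : ℝ :=
  ∫ z in {0}ᶜ, (z i) ^ 2 ∂(N x)

/-- `∫_{|z|≥1} z^{(i)} N(x, dz)`. -/
def largeJumpMean {d : ℕ} (N : EuclideanSpace ℝ (Fin d) → Measure (EuclideanSpace ℝ (Fin d)))
    (i : Fin d) (x : EuclideanSpace ℝ (Fin d)) : ℝ :=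
  ∫ z in {z | 1 ≤ ‖z‖}, z i ∂(N x)

end FellerMoment

end

/-!
For a linear form `ℓ`, the generator is applied to smooth compactly supported truncations of
`p y = ℓ (y - x₀) ^ k` with `k ≤ 2`. Obtaining the truncations by scaling one fixed function makes
their Taylor remainders at most `K ‖z‖²`, uniformly. A nonnegative function `u` with this property
satisfies `‖u'‖² ≤ 4 K u`, so the drift `u' z` of the large jumps is controlled by `1 + u` and the
generator satisfies `|L u| ≤ C (1 + u)` for the truncations `u` of `ℓ (y - x₀) ^ 2`. Grönwall's
inequality and Fatou's lemma then bound the second moments of the process.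

These moments dominate everything that occurs in Dynkin's formula for the truncations, which hence
passes to the limit `p`: the case `k = 0` says that the process does not reach `Δ`, and the cases
`k = 1` and `k = 2` are the formulas for the first and second moments.
-/

noncomputable section

namespace FellerMoment

section Calculus

variable {E : Type*} [NormedAddCommGroup E] [NormedSpace ℝ E]

/-- The remainder of `u (x + z)` after its first-order Taylor expansion at `x`. -/
def taylorRemainder (u : E → ℝ) (x z : E) : ℝ :=
  u (x + z) - u x - fderiv ℝ u x z

theorem abs_taylorRemainder_le_of_lipschitzWith_fderiv {u : E → ℝ} (hu : Differentiable ℝ u)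
    {K : ℝ≥0} (hK : LipschitzWith K (fderiv ℝ u)) (x z : E) :
    |taylorRemainder u x z| ≤ K * ‖z‖ ^ 2 := by
  have hfderiv : ∀ y ∈ Metric.closedBall x ‖z‖, ‖fderiv ℝ u y - fderiv ℝ u x‖ ≤ K * ‖z‖ :=
    fun y hy => (hK.norm_sub_le y x).trans
      (mul_le_mul_of_nonneg_left (mem_closedBall_iff_norm.1 hy) K.2)
  have h := (convex_closedBall x ‖z‖).norm_image_sub_le_of_norm_fderiv_le' (𝕜 := ℝ)
    (x := x) (y := x + z) (fun y _ => hu y) hfderiv (by simp) (by simp)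
  rwa [add_sub_cancel_left, mul_assoc, ← pow_two] at h

theorem exists_abs_taylorRemainder_le {u : E → ℝ} (hu : ContDiff ℝ 2 u)
    (hc : HasCompactSupport u) : ∃ K, 0 ≤ K ∧ ∀ x z, |taylorRemainder u x z| ≤ K * ‖z‖ ^ 2 := by
  obtain ⟨K, hK⟩ := ContDiff.lipschitzWith_of_hasCompactSupport (𝕂 := ℝ) (hc.fderiv ℝ)
    (hu.fderiv_right (m := 1) (by norm_num)) one_ne_zero
  exact ⟨K, K.2, abs_taylorRemainder_le_of_lipschitzWith_fderiv (hu.differentiable two_ne_zero) hK⟩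

theorem fderiv_const_mul_comp_smul_sub (u : E → ℝ) (c a : ℝ) (x₀ x : E) :
    fderiv ℝ (fun y => c * u (a • (y - x₀))) x = c • a • fderiv ℝ u (a • (x - x₀)) := by
  have h : (fun y => c * u (a • (y - x₀))) = c • fun y => u (a • (y - x₀)) := rfl
  rw [h, fderiv_const_smul_field, Pi.smul_apply, fderiv_comp_sub (f := fun y => u (a • y)),
    fderiv_comp_smul]

theorem taylorRemainder_const_mul_comp_smul_sub (u : E → ℝ) (c a : ℝ) (x₀ x z : E) :
    taylorRemainder (fun y => c * u (a • (y - x₀))) x z =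
      c * taylorRemainder u (a • (x - x₀)) (a • z) := by
  simp only [taylorRemainder, fderiv_const_mul_comp_smul_sub, _root_.smul_apply,
    map_smul, smul_eq_mul, add_sub_right_comm, smul_add]
  ring

-- The quadratic polynomial `r ↦ u x + r u'(x) z + r² K ‖z‖²` is nonnegative.
theorem norm_fderiv_sq_le {u : E → ℝ} (hu : ∀ y, 0 ≤ u y) {K : ℝ} (hK : 0 ≤ K) {x : E}
    (h : ∀ z, |taylorRemainder u x z| ≤ K * ‖z‖ ^ 2) : ‖fderiv ℝ u x‖ ^ 2 ≤ 4 * K * u x := by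
  have hKu : 0 ≤ 4 * K * u x := mul_nonneg (by positivity) (hu x)
  rw [← Real.le_sqrt (norm_nonneg _) hKu]
  refine ContinuousLinearMap.opNorm_le_bound _ (Real.sqrt_nonneg _) fun z => ?_
  have hdiscrim : discrim (K * ‖z‖ ^ 2) (fderiv ℝ u x z) (u x) ≤ 0 :=
    discrim_le_zero fun r => by
      have hr := (abs_le.1 (h (r • z))).2
      have hpos := hu (x + r • z)
      rw [taylorRemainder, norm_smul, mul_pow, Real.norm_eq_abs, sq_abs, map_smul,
        smul_eq_mul] at hr
      linarith
  rw [Real.norm_eq_abs]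
  refine abs_le_of_sq_le_sq ?_ (by positivity)
  rw [mul_pow, Real.sq_sqrt hKu]
  rw [discrim] at hdiscrim
  linarith

end Calculus

section TruncatedPowers

variable {E : Type*} [NormedAddCommGroup E] [NormedSpace ℝ E]

/-- The power `(ℓ y - ℓ x₀) ^ k` of a linear form centred at `x₀`. -/
def centeredPow (ℓ : E →L[ℝ] ℝ) (k : ℕ) (x₀ y : E) : ℝ := ℓ (y - x₀) ^ k

theorem hasFDerivAt_centeredPow (ℓ : E →L[ℝ] ℝ) (k : ℕ) (x₀ x : E) :
    HasFDerivAt (centeredPow ℓ k x₀) ((k * ℓ (x - x₀) ^ (k - 1)) • ℓ) x := by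
  have h : HasFDerivAt (fun y => ℓ (y - x₀)) ℓ x :=
    ℓ.hasFDerivAt.comp x ((hasFDerivAt_id x).sub_const x₀)
  exact (h.pow k).congr_fderiv (by rw [nsmul_eq_mul])

theorem abs_centeredPow_le_one_add (ℓ : E →L[ℝ] ℝ) {k : ℕ} (hk : k ≤ 2) (x₀ y : E) :
    |centeredPow ℓ k x₀ y| ≤ 1 + centeredPow ℓ 2 x₀ y := by
  simp only [centeredPow]
  interval_cases k
  · simpa using sq_nonneg (ℓ (y - x₀))
  · rw [pow_one]
    nlinarith [sq_nonneg (|ℓ (y - x₀)| - 1), sq_abs (ℓ (y - x₀)), abs_nonneg (ℓ (y - x₀))]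
  · rw [abs_of_nonneg (sq_nonneg _)]
    linarith

variable [FiniteDimensional ℝ E]

/-- The power `ℓ y ^ k` of a linear form, multiplied by a smooth bump function that equals `1` on
the unit ball and vanishes outside the ball of radius `2`. -/
def bumpPow (ℓ : E →L[ℝ] ℝ) (k : ℕ) (y : E) : ℝ :=
  ℓ y ^ k * (default : ContDiffBump (0 : E)) y

/-- The power `ℓ (y - x₀) ^ k` truncated smoothly outside the ball of radius `n + 1` around `x₀`.
It is obtained from `bumpPow` by scaling, which makes its derivative bounds uniform in `n`. -/
def truncPow (ℓ : E →L[ℝ] ℝ) (k : ℕ) (x₀ : E) (n : ℕ) (y : E) : ℝ :=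
  ((n : ℝ) + 1) ^ k * bumpPow ℓ k (((n : ℝ) + 1)⁻¹ • (y - x₀))

variable (ℓ : E →L[ℝ] ℝ) (k : ℕ) (x₀ : E) (n : ℕ)

theorem contDiff_bumpPow {m : ℕ∞} : ContDiff ℝ m (bumpPow ℓ k) :=
  (ℓ.contDiff.pow k).mul (default : ContDiffBump (0 : E)).contDiff

theorem hasCompactSupport_bumpPow : HasCompactSupport (bumpPow ℓ k) :=
  (default : ContDiffBump (0 : E)).hasCompactSupport.mul_left

theorem contDiff_truncPow {m : ℕ∞} : ContDiff ℝ m (truncPow ℓ k x₀ n) :=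
  contDiff_const.mul ((contDiff_bumpPow ℓ k).comp
    (contDiff_const.smul (contDiff_id.sub contDiff_const)))

theorem hasCompactSupport_truncPow : HasCompactSupport (truncPow ℓ k x₀ n) :=
  ((hasCompactSupport_bumpPow ℓ k).comp_homeomorph
    ((Homeomorph.subRight x₀).trans
      (Homeomorph.smulOfNeZero ((n : ℝ) + 1)⁻¹ (by positivity)))).mul_left

theorem truncPow_eq_centeredPow_mul (y : E) :
    truncPow ℓ k x₀ n y = centeredPow ℓ k x₀ y *
      (default : ContDiffBump (0 : E)) (((n : ℝ) + 1)⁻¹ • (y - x₀)) := by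
  rw [truncPow, bumpPow, centeredPow, map_smul, smul_eq_mul, ← mul_assoc, ← mul_pow,
    mul_inv_cancel_left₀ (by positivity)]

theorem abs_truncPow_le (y : E) : |truncPow ℓ k x₀ n y| ≤ |centeredPow ℓ k x₀ y| := by
  rw [truncPow_eq_centeredPow_mul, abs_mul, abs_of_nonneg (ContDiffBump.nonneg _)]
  exact mul_le_of_le_one_right (abs_nonneg _) (ContDiffBump.le_one _)

variable {k} in
theorem truncPow_nonneg (hk : Even k) (y : E) : 0 ≤ truncPow ℓ k x₀ n y := by
  rw [truncPow_eq_centeredPow_mul]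
  exact mul_nonneg (hk.pow_nonneg _) (ContDiffBump.nonneg _)

theorem truncPow_eq_centeredPow_of_norm_sub_le {y : E} (hy : ‖y - x₀‖ ≤ n + 1) :
    truncPow ℓ k x₀ n y = centeredPow ℓ k x₀ y := by
  rw [truncPow_eq_centeredPow_mul, ContDiffBump.one_of_mem_closedBall, mul_one]
  rw [mem_closedBall_zero_iff, norm_smul, norm_inv, Real.norm_of_nonneg (by positivity)]
  exact inv_mul_le_one_of_le₀ hy (by positivity)

theorem eventually_truncPow_eventuallyEq (x : E) :
    ∀ᶠ n in atTop, truncPow ℓ k x₀ n =ᶠ[𝓝 x] centeredPow ℓ k x₀ := by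
  obtain ⟨m, hm⟩ := exists_nat_gt ‖x - x₀‖
  filter_upwards [eventually_ge_atTop m] with n hn
  have hcont : Continuous fun y : E => ‖y - x₀‖ := by fun_prop
  filter_upwards [(hcont.tendsto x).eventually (gt_mem_nhds hm)] with y hy
  refine truncPow_eq_centeredPow_of_norm_sub_le ℓ k x₀ n (hy.le.trans ?_)
  exact_mod_cast hn.trans n.le_succ

theorem tendsto_truncPow (x : E) :
    Tendsto (fun n => truncPow ℓ k x₀ n x) atTop (𝓝 (centeredPow ℓ k x₀ x)) :=
  tendsto_const_nhds.congr' <|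
    (eventually_truncPow_eventuallyEq ℓ k x₀ x).mono fun _ h => h.eq_of_nhds.symm

variable {k}

theorem exists_abs_taylorRemainder_truncPow_le (hk : k ≤ 2) :
    ∃ K, 0 ≤ K ∧ ∀ x₀ n x z, |taylorRemainder (truncPow ℓ k x₀ n) x z| ≤ K * ‖z‖ ^ 2 := by
  obtain ⟨K, hK0, hK⟩ := exists_abs_taylorRemainder_le (contDiff_bumpPow ℓ k)
    (hasCompactSupport_bumpPow ℓ k)
  refine ⟨K, hK0, fun x₀ n x z => ?_⟩
  have hn : (1 : ℝ) ≤ n + 1 := by simp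
  calc |taylorRemainder (truncPow ℓ k x₀ n) x z|
      = ((n : ℝ) + 1) ^ k * |taylorRemainder (bumpPow ℓ k)
          (((n : ℝ) + 1)⁻¹ • (x - x₀)) (((n : ℝ) + 1)⁻¹ • z)| := by
        unfold truncPow
        rw [taylorRemainder_const_mul_comp_smul_sub, abs_mul, abs_of_nonneg (by positivity)]
    _ ≤ ((n : ℝ) + 1) ^ 2 * (K * ‖((n : ℝ) + 1)⁻¹ • z‖ ^ 2) := by
        gcongr
        exact hK _ _
    _ = K * ‖z‖ ^ 2 := by
        rw [norm_smul, norm_inv, Real.norm_of_nonneg (by positivity)]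
        field_simp

theorem exists_norm_fderiv_truncPow_le (hk : k ≤ 1) :
    ∃ G, ∀ x₀ n x, ‖fderiv ℝ (truncPow ℓ k x₀ n) x‖ ≤ G := by
  obtain ⟨G, hG⟩ := ((hasCompactSupport_bumpPow ℓ k).fderiv ℝ).exists_bound_of_continuous
    ((contDiff_bumpPow ℓ k (m := 1)).continuous_fderiv (by simp))
  refine ⟨G, fun x₀ n x => ?_⟩
  have hn : (1 : ℝ) ≤ n + 1 := by simp
  calc ‖fderiv ℝ (truncPow ℓ k x₀ n) x‖
      = ((n : ℝ) + 1) ^ k * (((n : ℝ) + 1)⁻¹ *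
          ‖fderiv ℝ (bumpPow ℓ k) (((n : ℝ) + 1)⁻¹ • (x - x₀))‖) := by
        unfold truncPow
        rw [fderiv_const_mul_comp_smul_sub, norm_smul, norm_smul,
          Real.norm_of_nonneg (by positivity), Real.norm_of_nonneg (by positivity)]
    _ ≤ ((n : ℝ) + 1) ^ 1 * (((n : ℝ) + 1)⁻¹ * G) := by
        gcongr
        exact hG _
    _ = G := by field_simp

theorem exists_norm_fderiv_truncPow_le_one_add (hk : k ≤ 2) :
    ∃ G, 0 ≤ G ∧ ∀ x₀ n x,
      ‖fderiv ℝ (truncPow ℓ k x₀ n) x‖ ≤ G * (1 + |truncPow ℓ k x₀ n x|) := by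
  rcases hk.lt_or_eq with hk | rfl
  · obtain ⟨G, hG⟩ := exists_norm_fderiv_truncPow_le ℓ (Nat.le_of_lt_succ hk)
    have hG0 : 0 ≤ G := (norm_nonneg _).trans (hG 0 0 0)
    exact ⟨G, hG0, fun x₀ n x => (hG x₀ n x).trans
      (le_mul_of_one_le_right hG0 (le_add_of_nonneg_right (abs_nonneg _)))⟩
  · obtain ⟨K, hK0, hK⟩ := exists_abs_taylorRemainder_truncPow_le ℓ le_rfl
    refine ⟨1 + 4 * K, by positivity, fun x₀ n x => ?_⟩
    have hsq := norm_fderiv_sq_le (truncPow_nonneg ℓ x₀ n even_two) hK0 (hK x₀ n x)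
    have hu := abs_nonneg (truncPow ℓ 2 x₀ n x)
    rw [← abs_of_nonneg (truncPow_nonneg ℓ x₀ n even_two x)] at hsq
    nlinarith [sq_nonneg (‖fderiv ℝ (truncPow ℓ 2 x₀ n) x‖ - 1)]

end TruncatedPowers

section JumpIntegrand

variable {E : Type*} [NormedAddCommGroup E] [NormedSpace ℝ E]

/-- The integrand `u (x + z) - u x - u'(x) z 1_{‖z‖ < 1}` of a pure-jump generator, written as a
Taylor remainder plus a drift coming from the large jumps. -/
def jumpIntegrand (u : E → ℝ) (x z : E) : ℝ :=
  taylorRemainder u x z + Set.indicator {z | 1 ≤ ‖z‖} (fderiv ℝ u x) z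

theorem abs_indicator_one_le_norm_le (A : E →L[ℝ] ℝ) (z : E) :
    |Set.indicator {z | 1 ≤ ‖z‖} A z| ≤ ‖A‖ * ‖z‖ ^ 2 := by
  by_cases hz : 1 ≤ ‖z‖
  · rw [Set.indicator_of_mem (s := {z : E | 1 ≤ ‖z‖}) hz]
    exact (A.le_opNorm z).trans
      (mul_le_mul_of_nonneg_left (le_self_pow₀ hz two_ne_zero) (norm_nonneg A))
  · rw [Set.indicator_of_notMem (s := {z : E | 1 ≤ ‖z‖}) hz, abs_zero]
    positivity

theorem sq_apply_le_opNorm_sq_mul (A : E →L[ℝ] ℝ) (z : E) : A z ^ 2 ≤ ‖A‖ ^ 2 * ‖z‖ ^ 2 := by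
  rw [← mul_pow, ← sq_abs (A z)]
  exact pow_le_pow_left₀ (abs_nonneg _) (A.le_opNorm z) 2

theorem abs_jumpIntegrand_le {u : E → ℝ} {x z : E} {K : ℝ}
    (h : |taylorRemainder u x z| ≤ K * ‖z‖ ^ 2) :
    |jumpIntegrand u x z| ≤ (K + ‖fderiv ℝ u x‖) * ‖z‖ ^ 2 := by
  rw [add_mul]
  exact (abs_add_le _ _).trans (add_le_add h (abs_indicator_one_le_norm_le _ z))

theorem tendsto_jumpIntegrand {u : ℕ → E → ℝ} {p : E → ℝ} {x : E}
    (hx : ∀ᶠ n in atTop, u n =ᶠ[𝓝 x] p)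
    (hu : ∀ y, Tendsto (fun n => u n y) atTop (𝓝 (p y))) (z : E) :
    Tendsto (fun n => jumpIntegrand (u n) x z) atTop (𝓝 (jumpIntegrand p x z)) := by
  have hlocal : ∀ᶠ n in atTop, (u n (x + z) - p x - fderiv ℝ p x z) +
      Set.indicator {z | 1 ≤ ‖z‖} (fderiv ℝ p x) z = jumpIntegrand (u n) x z := by
    filter_upwards [hx] with n hn
    rw [jumpIntegrand, taylorRemainder, hn.fderiv_eq, hn.eq_of_nhds]
  exact ((((hu (x + z)).sub_const _).sub_const _).add_const _).congr' hlocal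

theorem jumpIntegrand_centeredPow_zero (ℓ : E →L[ℝ] ℝ) (x₀ x z : E) :
    jumpIntegrand (centeredPow ℓ 0 x₀) x z = 0 := by
  simp [jumpIntegrand, taylorRemainder, (hasFDerivAt_centeredPow ℓ 0 x₀ x).fderiv, centeredPow]

theorem jumpIntegrand_centeredPow_one (ℓ : E →L[ℝ] ℝ) (x₀ x z : E) :
    jumpIntegrand (centeredPow ℓ 1 x₀) x z = Set.indicator {z | 1 ≤ ‖z‖} ℓ z := by
  simp [jumpIntegrand, taylorRemainder, (hasFDerivAt_centeredPow ℓ 1 x₀ x).fderiv, centeredPow]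

theorem jumpIntegrand_centeredPow_two (ℓ : E →L[ℝ] ℝ) (x₀ x z : E) :
    jumpIntegrand (centeredPow ℓ 2 x₀) x z =
      ℓ z ^ 2 + 2 * (ℓ (x - x₀) * Set.indicator {z | 1 ≤ ‖z‖} ℓ z) := by
  have hfderiv : fderiv ℝ (centeredPow ℓ 2 x₀) x = (2 * ℓ (x - x₀)) • ℓ := by
    simpa using (hasFDerivAt_centeredPow ℓ 2 x₀ x).fderiv
  have hremainder : taylorRemainder (centeredPow ℓ 2 x₀) x z = ℓ z ^ 2 := by
    rw [taylorRemainder, hfderiv, centeredPow, centeredPow, _root_.smul_apply, smul_eq_mul,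
      add_sub_right_comm, map_add]
    ring
  simp only [jumpIntegrand, hremainder, hfderiv, Set.indicator_apply]
  split_ifs <;> simp [mul_assoc]

variable [MeasurableSpace E] {μ : Measure E}

theorem abs_integral_indicator_one_le_norm_le (hμ : Integrable (fun z => ‖z‖ ^ 2) μ)
    (A : E →L[ℝ] ℝ) :
    |∫ z, Set.indicator {z | 1 ≤ ‖z‖} A z ∂μ| ≤ ‖A‖ * ∫ z, ‖z‖ ^ 2 ∂μ := by
  rw [← integral_const_mul]
  exact norm_integral_le_of_norm_le (f := Set.indicator {z | 1 ≤ ‖z‖} A) (hμ.const_mul _)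
    (ae_of_all _ (abs_indicator_one_le_norm_le A))

theorem abs_integral_jumpIntegrand_le (hμ : Integrable (fun z => ‖z‖ ^ 2) μ) {u : E → ℝ} {x : E}
    {K : ℝ} (h : ∀ z, |taylorRemainder u x z| ≤ K * ‖z‖ ^ 2) :
    |∫ z, jumpIntegrand u x z ∂μ| ≤ (K + ‖fderiv ℝ u x‖) * ∫ z, ‖z‖ ^ 2 ∂μ := by
  rw [← integral_const_mul]
  exact norm_integral_le_of_norm_le (f := jumpIntegrand u x) (hμ.const_mul _)
    (ae_of_all _ fun z => abs_jumpIntegrand_le (h z))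

variable [BorelSpace E]

theorem measurable_jumpIntegrand {u : E → ℝ} (hu : Continuous u) (x : E) :
    Measurable (jumpIntegrand u x) := by
  have hremainder : Continuous (taylorRemainder u x) :=
    ((hu.comp (continuous_const.add continuous_id)).sub continuous_const).sub
      (fderiv ℝ u x).continuous
  exact hremainder.measurable.add
    ((fderiv ℝ u x).continuous.measurable.indicator
      (measurableSet_le measurable_const measurable_norm))

theorem integrable_indicator_one_le_norm (hμ : Integrable (fun z => ‖z‖ ^ 2) μ)
    (A : E →L[ℝ] ℝ) : Integrable (Set.indicator {z | 1 ≤ ‖z‖} A) μ :=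
  (hμ.const_mul ‖A‖).mono'
    (A.continuous.measurable.indicator
      (measurableSet_le measurable_const measurable_norm)).aestronglyMeasurable
    (ae_of_all _ (abs_indicator_one_le_norm_le A))

theorem integrable_sq_apply (hμ : Integrable (fun z => ‖z‖ ^ 2) μ) (A : E →L[ℝ] ℝ) :
    Integrable (fun z => A z ^ 2) μ :=
  (hμ.const_mul (‖A‖ ^ 2)).mono' (A.continuous.pow 2).measurable.aestronglyMeasurable
    (ae_of_all _ fun z => by
      rw [Real.norm_of_nonneg (sq_nonneg _)]
      exact sq_apply_le_opNorm_sq_mul A z)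

theorem abs_integral_sq_apply_le (hμ : Integrable (fun z => ‖z‖ ^ 2) μ) (A : E →L[ℝ] ℝ) :
    |∫ z, A z ^ 2 ∂μ| ≤ ‖A‖ ^ 2 * ∫ z, ‖z‖ ^ 2 ∂μ := by
  rw [← integral_const_mul, abs_of_nonneg (integral_nonneg fun _ => sq_nonneg _)]
  exact integral_mono (integrable_sq_apply hμ A) (hμ.const_mul _) (sq_apply_le_opNorm_sq_mul A)

theorem tendsto_integral_jumpIntegrand (hμ : Integrable (fun z => ‖z‖ ^ 2) μ)
    {u : ℕ → E → ℝ} {p : E → ℝ} {x : E} {K : ℝ} (hcont : ∀ n, Continuous (u n))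
    (hK : ∀ n z, |taylorRemainder (u n) x z| ≤ K * ‖z‖ ^ 2)
    (hx : ∀ᶠ n in atTop, u n =ᶠ[𝓝 x] p)
    (hu : ∀ y, Tendsto (fun n => u n y) atTop (𝓝 (p y))) :
    Tendsto (fun n => ∫ z, jumpIntegrand (u n) x z ∂μ) atTop
      (𝓝 (∫ z, jumpIntegrand p x z ∂μ)) := by
  refine tendsto_integral_filter_of_dominated_convergence
    (fun z => (K + ‖fderiv ℝ p x‖) * ‖z‖ ^ 2)
    (Eventually.of_forall fun n => (measurable_jumpIntegrand (hcont n) x).aestronglyMeasurable)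
    ?_ (hμ.const_mul _) (ae_of_all _ (tendsto_jumpIntegrand hx hu))
  filter_upwards [hx] with n hn
  rw [← hn.fderiv_eq]
  exact ae_of_all _ fun z => abs_jumpIntegrand_le (hK n z)

end JumpIntegrand

section JumpOperator

variable {d : ℕ} {N : EuclideanSpace ℝ (Fin d) → Measure (EuclideanSpace ℝ (Fin d))}
  {x : EuclideanSpace ℝ (Fin d)}

theorem jumpOperator_eq_integral_jumpIntegrand (u : EuclideanSpace ℝ (Fin d) → ℝ) :
    jumpOperator N u x = ∫ z in {0}ᶜ, jumpIntegrand u x z ∂(N x) := by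
  refine integral_congr_ae (ae_of_all _ fun z => ?_)
  by_cases hz : ‖z‖ < 1
  · simp [jumpIntegrand, taylorRemainder, hz, inner_gradient_left]
  · simp [jumpIntegrand, taylorRemainder, hz, not_lt.1 hz]

theorem setIntegral_one_le_norm_eq (f : EuclideanSpace ℝ (Fin d) → ℝ) :
    ∫ z in {z | 1 ≤ ‖z‖}, f z ∂(N x) =
      ∫ z in {0}ᶜ, Set.indicator {z | 1 ≤ ‖z‖} f z ∂(N x) := by
  have hsubset : {z : EuclideanSpace ℝ (Fin d) | 1 ≤ ‖z‖} ⊆ {0}ᶜ := fun z (hz : 1 ≤ ‖z‖) =>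
    norm_pos_iff.1 (zero_lt_one.trans_le hz)
  rw [setIntegral_indicator (measurableSet_le measurable_const measurable_norm),
    Set.inter_eq_self_of_subset_right hsubset]

variable (ℓ : EuclideanSpace ℝ (Fin d) →L[ℝ] ℝ) (x₀ : EuclideanSpace ℝ (Fin d))

theorem jumpOperator_centeredPow_zero : jumpOperator N (centeredPow ℓ 0 x₀) x = 0 := by
  simp only [jumpOperator_eq_integral_jumpIntegrand, jumpIntegrand_centeredPow_zero,
    integral_zero]

theorem jumpOperator_centeredPow_one :
    jumpOperator N (centeredPow ℓ 1 x₀) x = ∫ z in {z | 1 ≤ ‖z‖}, ℓ z ∂(N x) := by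
  simp only [jumpOperator_eq_integral_jumpIntegrand, jumpIntegrand_centeredPow_one,
    setIntegral_one_le_norm_eq]

theorem jumpOperator_centeredPow_two
    (hx : Integrable (fun z => ‖z‖ ^ 2) ((N x).restrict {0}ᶜ)) :
    jumpOperator N (centeredPow ℓ 2 x₀) x =
      ∫ z in {0}ᶜ, ℓ z ^ 2 ∂(N x) + 2 * (ℓ (x - x₀) * ∫ z in {z | 1 ≤ ‖z‖}, ℓ z ∂(N x)) := by
  simp only [jumpOperator_eq_integral_jumpIntegrand, jumpIntegrand_centeredPow_two,
    setIntegral_one_le_norm_eq]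
  rw [integral_add (integrable_sq_apply hx ℓ)
    (((integrable_indicator_one_le_norm hx ℓ).const_mul _).const_mul _),
    integral_const_mul, integral_const_mul]

end JumpOperator

section ContractionSemigroup

variable {B : Type*} [NormedAddCommGroup B] [NormedSpace ℝ B]

/-- A strongly continuous contraction semigroup on a normed space, indexed by `t ≥ 0`; strong
continuity is only required at `0`. -/
structure IsContractionSemigroup (T : ℝ≥0 → B →L[ℝ] B) : Prop where
  zero_apply : ∀ u, T 0 u = u
  add_apply : ∀ s t u, T (s + t) u = T s (T t u)
  norm_apply_le : ∀ t u, ‖T t u‖ ≤ ‖u‖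
  tendsto_zero : ∀ u, Tendsto (fun t => T t u) (𝓝[>] 0) (𝓝 u)

namespace IsContractionSemigroup

variable {T : ℝ≥0 → B →L[ℝ] B} (hT : IsContractionSemigroup T)
include hT

theorem dist_apply_le (s t : ℝ≥0) (u : B) : dist (T s u) (T t u) ≤ dist (T (nndist s t) u) u := by
  wlog hst : s ≤ t generalizing s t
  · rw [dist_comm, nndist_comm]
    exact this t s (le_of_not_ge hst)
  obtain ⟨r, rfl⟩ := exists_add_of_le hst
  have hr : nndist s (s + r) = r := NNReal.coe_injective (by simp [NNReal.dist_eq])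
  rw [hr, dist_comm, hT.add_apply, dist_eq_norm, dist_eq_norm, ← map_sub]
  exact hT.norm_apply_le _ _

theorem continuous_apply (u : B) : Continuous fun t => T t u := by
  have hzero : ContinuousAt (fun t => T t u) 0 := by
    rw [← continuousWithinAt_univ, ← Set.Ici_zero_eq_univ,
      ← continuousWithinAt_Ioi_iff_Ici, ContinuousWithinAt, hT.zero_apply]
    exact hT.tendsto_zero u
  refine continuous_iff_continuousAt.2 fun t => tendsto_iff_dist_tendsto_zero.2 ?_
  have hdist : Tendsto (fun s : ℝ≥0 => nndist s t) (𝓝 t) (𝓝 0) := by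
    have hcont : Continuous fun s : ℝ≥0 => nndist s t := by fun_prop
    simpa using hcont.tendsto t
  refine squeeze_zero (fun _ => dist_nonneg) (fun s => hT.dist_apply_le s t u) ?_
  rw [ContinuousAt, hT.zero_apply] at hzero
  exact tendsto_iff_dist_tendsto_zero.1 (hzero.comp hdist)

theorem hasDerivWithinAt_apply {u v : B}
    (huv : Tendsto (fun t : ℝ≥0 => (t : ℝ)⁻¹ • (T t u - u)) (𝓝[>] 0) (𝓝 v)) {t : ℝ} (ht : 0 ≤ t) :
    HasDerivWithinAt (fun r : ℝ => T r.toNNReal u) (T t.toNNReal v) (Set.Ici t) t := by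
  rw [← hasDerivWithinAt_Ioi_iff_Ici, hasDerivWithinAt_iff_tendsto_slope' Set.self_notMem_Ioi]
  have hshift : Tendsto (fun r : ℝ => (r - t).toNNReal) (𝓝[>] t) (𝓝[>] 0) := by
    refine tendsto_nhdsWithin_iff.2 ⟨?_, ?_⟩
    · have hcont : Continuous fun r : ℝ => (r - t).toNNReal := by fun_prop
      simpa using (hcont.tendsto t).mono_left nhdsWithin_le_nhds
    · filter_upwards [self_mem_nhdsWithin] with r hr
      simpa using hr
  refine (((T t.toNNReal).continuous.tendsto v).comp (huv.comp hshift)).congr' ?_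
  filter_upwards [self_mem_nhdsWithin] with r (hr : t < r)
  have hadd : r.toNNReal = t.toNNReal + (r - t).toNNReal := by
    rw [← Real.toNNReal_add ht (sub_nonneg.2 hr.le), add_sub_cancel]
  simp only [Function.comp_apply, map_smul, map_sub]
  rw [slope_def_module, hadd, hT.add_apply, Real.coe_toNNReal _ (sub_nonneg.2 hr.le)]

theorem integral_apply_generator [CompleteSpace B] {u v : B}
    (huv : Tendsto (fun t : ℝ≥0 => (t : ℝ)⁻¹ • (T t u - u)) (𝓝[>] 0) (𝓝 v)) (t : ℝ≥0) :
    ∫ s in (0 : ℝ)..t, T s.toNNReal v = T t u - u := by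
  have hcont : ∀ w, Continuous fun s : ℝ => T s.toNNReal w := fun w =>
    (hT.continuous_apply w).comp continuous_real_toNNReal
  rw [intervalIntegral.integral_eq_sub_of_hasDeriv_right (hcont u).continuousOn
    (fun s hs => (hT.hasDerivWithinAt_apply huv ?_).mono Set.Ioi_subset_Ici_self)
    ((hcont v).intervalIntegrable _ _)]
  · simp [hT.zero_apply]
  · exact (le_min le_rfl t.coe_nonneg).trans hs.1.le

end IsContractionSemigroup

end ContractionSemigroup

/-- Evaluation at a point, as a continuous linear form on `C₀(α, ℝ)`. -/
def evalC₀ {α : Type*} [TopologicalSpace α] (x : α) : C₀(α, ℝ) →L[ℝ] ℝ :=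
  LinearMap.mkContinuous
    { toFun := fun u => u x, map_add' := fun _ _ => rfl, map_smul' := fun _ _ => rfl } 1
    fun u => by
      rw [one_mul, ← ZeroAtInftyContinuousMap.norm_toBCF_eq_norm]
      exact u.toBCF.norm_coe_le_norm x

section RightContinuous

variable {Ω β : Type*} [MeasurableSpace Ω]

/-- The smallest multiple of `1 / (n + 1)` that is strictly greater than `t`. It takes countably
many values and approximates `t` from the right, which makes right-continuous processes measurable
in time. -/
def gridPoint (n : ℕ) (t : ℝ≥0) : ℝ≥0 := (⌊((n : ℝ≥0) + 1) * t⌋₊ + 1) / ((n : ℝ≥0) + 1)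

theorem tendsto_gridPoint (t : ℝ≥0) : Tendsto (fun n => gridPoint n t) atTop (𝓝[≥] t) := by
  have hlower : ∀ n, t ≤ gridPoint n t := fun n => by
    rw [gridPoint, le_div_iff₀ (by positivity), mul_comm]
    exact (Nat.lt_floor_add_one _).le
  have hupper : ∀ n : ℕ, gridPoint n t ≤ t + 1 / ((n : ℝ≥0) + 1) := fun n => by
    rw [gridPoint, div_le_iff₀ (by positivity), add_mul t, one_div,
      inv_mul_cancel₀ (by positivity), mul_comm t]
    gcongr
    exact Nat.floor_le (by positivity)
  have hmesh : Tendsto (fun n : ℕ => t + 1 / ((n : ℝ≥0) + 1)) atTop (𝓝 t) := by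
    simpa using tendsto_one_div_add_atTop_nhds_zero_nat.const_add t
  exact tendsto_nhdsWithin_iff.2 ⟨tendsto_of_tendsto_of_tendsto_of_le_of_le tendsto_const_nhds
    hmesh hlower hupper, Eventually.of_forall hlower⟩

theorem measurable_gridPoint_process [MeasurableSpace β] {X : ℝ≥0 → Ω → β}
    (hX : ∀ t, Measurable (X t)) (n : ℕ) :
    Measurable fun q : ℝ≥0 × Ω => X (gridPoint n q.1) q.2 := by
  have hindex : ∀ (g : ℕ → ℝ≥0) {φ : ℝ≥0 → ℕ}, Measurable φ →
      Measurable fun q : ℝ≥0 × Ω => X (g (φ q.1)) q.2 := fun g φ hφ =>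
    (measurable_from_prod_countable_right (f := fun p : ℕ × Ω => X (g p.1) p.2)
      fun m => hX (g m)).comp (hφ.prodMap measurable_id)
  have hfloor : Measurable fun t : ℝ≥0 => ⌊((n : ℝ≥0) + 1) * t⌋₊ :=
    Nat.measurable_floor.comp (measurable_id.const_mul _)
  have hgrid := hindex (fun m => (m + 1) / ((n : ℝ≥0) + 1)) hfloor
  exact hgrid

theorem aemeasurable_prod_of_continuousWithinAt_Ici [TopologicalSpace β]
    [TopologicalSpace.PseudoMetrizableSpace β] [MeasurableSpace β] [BorelSpace β]
    {X : ℝ≥0 → Ω → β} {P : Measure Ω} [SFinite P] (hX : ∀ t, Measurable (X t))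
    (hcont : ∀ᵐ ω ∂P, ∀ t, ContinuousWithinAt (fun s => X s ω) (Set.Ici t) t)
    {α : Type*} [MeasurableSpace α] {τ : α → ℝ≥0} (hτ : Measurable τ) (μ : Measure α)
    [SFinite μ] : AEMeasurable (fun q : α × Ω => X (τ q.1) q.2) (μ.prod P) := by
  refine aemeasurable_of_tendsto_metrizable_ae atTop (fun n => ((measurable_gridPoint_process hX
    n).comp ((hτ.comp measurable_fst).prodMk measurable_snd)).aemeasurable) ?_
  filter_upwards [Measure.quasiMeasurePreserving_snd.ae hcont] with q hq
  exact (hq (τ q.1)).tendsto.comp (tendsto_gridPoint (τ q.1))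

end RightContinuous

section OnePoint

theorem measurable_onePoint_elim {α β : Type*} [TopologicalSpace α] [MeasurableSpace α]
    [BorelSpace α] [MeasurableSpace (OnePoint α)] [BorelSpace (OnePoint α)] [MeasurableSpace β]
    {f : α → β} (hf : Measurable f) (b : β) : Measurable fun p : OnePoint α => p.elim b f := by
  have hcoe : MeasurableEmbedding ((↑) : α → OnePoint α) :=
    OnePoint.isOpenEmbedding_coe.measurableEmbedding
  convert hcoe.measurable_extend hf (measurable_const (a := b)) using 1
  funext p
  induction p using OnePoint.rec with
  | infty => exact (Function.extend_apply' f (fun _ => b) _ OnePoint.infty_notMem_range_coe).symm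
  | coe x => exact (hcoe.injective.extend_apply _ _ _).symm

instance instMetrizableSpaceCompactified (d : ℕ) :
    TopologicalSpace.MetrizableSpace (Compactified d) :=
  (onePointEquivSphereOfFinrankEq (ι := Fin (d + 1)) (V := EuclideanSpace ℝ (Fin d))
    (by simp)).isEmbedding.metrizableSpace

variable {d : ℕ}

@[simp] theorem extendZero_coe (u : EuclideanSpace ℝ (Fin d) → ℝ) (x : EuclideanSpace ℝ (Fin d)) :
    extendZero u (x : Compactified d) = u x := rfl

@[simp] theorem extendZero_infty (u : EuclideanSpace ℝ (Fin d) → ℝ) :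
    extendZero u OnePoint.infty = 0 := rfl

theorem extendZero_eq_of_ne_infty (u : EuclideanSpace ℝ (Fin d) → ℝ) {p : Compactified d}
    (hp : p ≠ OnePoint.infty) : extendZero u p = u (position p) := by
  obtain ⟨x, rfl⟩ := OnePoint.ne_infty_iff_exists.1 hp
  rfl

theorem measurable_extendZero {u : EuclideanSpace ℝ (Fin d) → ℝ} (hu : Measurable u) :
    Measurable (extendZero u) :=
  measurable_onePoint_elim hu 0

theorem measurable_position : Measurable (position (d := d)) :=
  measurable_onePoint_elim measurable_id 0

theorem tendsto_extendZero {u : ℕ → EuclideanSpace ℝ (Fin d) → ℝ}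
    {p : EuclideanSpace ℝ (Fin d) → ℝ} (h : ∀ x, Tendsto (fun n => u n x) atTop (𝓝 (p x)))
    (a : Compactified d) : Tendsto (fun n => extendZero (u n) a) atTop (𝓝 (extendZero p a)) := by
  induction a using OnePoint.rec with
  | infty => exact tendsto_const_nhds
  | coe x => exact h x

theorem extendZero_nonneg {u : EuclideanSpace ℝ (Fin d) → ℝ} (hu : ∀ x, 0 ≤ u x)
    (p : Compactified d) : 0 ≤ extendZero u p := by
  induction p using OnePoint.rec with
  | infty => exact le_rfl
  | coe x => exact hu x

theorem abs_extendZero_le {u v : EuclideanSpace ℝ (Fin d) → ℝ} {C : ℝ} (hC : 0 ≤ C)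
    (h : ∀ x, |u x| ≤ C * (1 + v x)) (p : Compactified d) :
    |extendZero u p| ≤ C * (1 + extendZero v p) := by
  induction p using OnePoint.rec with
  | infty => simpa using hC
  | coe x => exact h x

theorem abs_extendZero_le_norm (u : C₀(EuclideanSpace ℝ (Fin d), ℝ)) (p : Compactified d) :
    |extendZero u p| ≤ ‖u‖ := by
  induction p using OnePoint.rec with
  | infty => simp
  | coe x => exact u.toBCF.norm_coe_le_norm x

end OnePoint

namespace FellerProcess

variable {d : ℕ} {Ω : Type*} [MeasurableSpace Ω] (𝕏 : FellerProcess d Ω)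

instance (x : EuclideanSpace ℝ (Fin d)) : IsProbabilityMeasure (𝕏.P x) :=
  𝕏.isProbabilityMeasure x

theorem measurable_X (t : ℝ≥0) : Measurable (𝕏.X t) :=
  (𝕏.adapted t).mono (𝕏.ℱ.le t) le_rfl

theorem integrable_extendZero (u : C₀(EuclideanSpace ℝ (Fin d), ℝ)) (t : ℝ≥0)
    (x : EuclideanSpace ℝ (Fin d)) :
    Integrable (fun ω => extendZero u (𝕏.X t ω)) (𝕏.P x) :=
  Integrable.of_bound ((measurable_extendZero u.continuous.measurable).comp
    (𝕏.measurable_X t)).aestronglyMeasurable ‖u‖ (ae_of_all _ fun _ => abs_extendZero_le_norm u _)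

theorem norm_semigroup_le (t : ℝ≥0) (u : C₀(EuclideanSpace ℝ (Fin d), ℝ)) :
    ‖𝕏.semigroup t u‖ ≤ ‖u‖ := by
  rw [← (𝕏.semigroup t u).norm_toBCF_eq_norm, BoundedContinuousFunction.norm_le (norm_nonneg u)]
  intro x
  have h := norm_integral_le_of_norm_le_const (μ := 𝕏.P x)
    (f := fun ω => extendZero u (𝕏.X t ω))
    (ae_of_all _ fun ω => abs_extendZero_le_norm u (𝕏.X t ω))
  rw [probReal_univ, mul_one, ← semigroup_apply] at h
  exact h

/-- The Feller semigroup, as continuous linear operators on `C_∞(ℝᵈ)`. -/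
def semigroupCLM (t : ℝ≥0) :
    C₀(EuclideanSpace ℝ (Fin d), ℝ) →L[ℝ] C₀(EuclideanSpace ℝ (Fin d), ℝ) :=
  LinearMap.mkContinuous
    { toFun := 𝕏.semigroup t
      map_add' := fun u v => by
        ext x
        have h := integral_add (𝕏.integrable_extendZero u t x) (𝕏.integrable_extendZero v t x)
        simp only [← semigroup_apply] at h
        rw [ZeroAtInftyContinuousMap.add_apply, ← h, semigroup_apply]
        exact integral_congr_ae (ae_of_all _ fun ω => by
          dsimp only
          induction 𝕏.X t ω using OnePoint.rec <;> simp)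
      map_smul' := fun c u => by
        ext x
        simp only [ZeroAtInftyContinuousMap.smul_apply, RingHom.id_apply, semigroup_apply,
          ← integral_smul]
        exact integral_congr_ae (ae_of_all _ fun ω => by
          dsimp only
          induction 𝕏.X t ω using OnePoint.rec <;> simp) }
    1 fun u => (one_mul ‖u‖).symm ▸ 𝕏.norm_semigroup_le t u

theorem semigroupCLM_apply (t : ℝ≥0) (u : C₀(EuclideanSpace ℝ (Fin d), ℝ)) :
    𝕏.semigroupCLM t u = 𝕏.semigroup t u := rfl

theorem coe_semigroup (t : ℝ≥0) (u : C₀(EuclideanSpace ℝ (Fin d), ℝ)) :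
    (𝕏.semigroup t u : EuclideanSpace ℝ (Fin d) → ℝ) = transition 𝕏.X 𝕏.P t u :=
  funext (𝕏.semigroup_apply t u)

theorem isContractionSemigroup_semigroupCLM : IsContractionSemigroup 𝕏.semigroupCLM where
  zero_apply u := by
    ext x
    have hstart : (fun ω => extendZero u (𝕏.X 0 ω)) =ᵐ[𝕏.P x] fun _ => u x := by
      filter_upwards [𝕏.start x] with ω hω
      rw [hω, extendZero_coe]
    exact (𝕏.semigroup_apply 0 u x).trans ((integral_congr_ae hstart).trans (by simp))
  add_apply s t u := by
    ext x
    simp only [semigroupCLM_apply]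
    rw [semigroup_apply, semigroup_apply, coe_semigroup, ← integral_condExp (𝕏.ℱ.le s)]
    exact integral_congr_ae (𝕏.markov x s t u u.continuous.measurable
      ⟨‖u‖, u.toBCF.norm_coe_le_norm⟩)
  norm_apply_le := 𝕏.norm_semigroup_le
  tendsto_zero u := by
    rw [ZeroAtInftyContinuousMap.tendsto_iff_tendstoUniformly]
    simp only [semigroupCLM_apply, coe_semigroup]
    exact 𝕏.strongly_continuous u

theorem hasGenerator_generator {u : C₀(EuclideanSpace ℝ (Fin d), ℝ)}
    (hu : u ∈ 𝕏.generatorDomain) : 𝕏.HasGenerator u (𝕏.generator u) := by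
  have hexists : ∃ v, 𝕏.HasGenerator u v := hu
  rw [generator, dif_pos hexists]
  exact Classical.choose_spec hexists

/-- The map `(s, ω) ↦ X_s(ω)`, with real times so that the Lebesgue measure is available. -/
def traj (q : ℝ × Ω) : Compactified d := 𝕏.X q.1.toNNReal q.2

/-- The measure `ds ⊗ ℙ_x` on `(0, t] × Ω`. -/
def timeMeasure (x : EuclideanSpace ℝ (Fin d)) (t : ℝ≥0) : Measure (ℝ × Ω) :=
  (volume.restrict (Set.Ioc (0 : ℝ) t)).prod (𝕏.P x)

instance (x : EuclideanSpace ℝ (Fin d)) (t : ℝ≥0) : IsFiniteMeasure (𝕏.timeMeasure x t) := by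
  unfold timeMeasure
  infer_instance

variable (x : EuclideanSpace ℝ (Fin d)) (t : ℝ≥0)

theorem aemeasurable_traj : AEMeasurable 𝕏.traj (𝕏.timeMeasure x t) :=
  aemeasurable_prod_of_continuousWithinAt_Ici 𝕏.measurable_X
    ((𝕏.cadlag x).mono fun _ h s => (h s).1) measurable_real_toNNReal _

theorem integrable_extendZero_traj (u : C₀(EuclideanSpace ℝ (Fin d), ℝ)) :
    Integrable (fun q => extendZero u (𝕏.traj q)) (𝕏.timeMeasure x t) :=
  Integrable.of_bound ((measurable_extendZero u.continuous.measurable).comp_aemeasurable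
    (𝕏.aemeasurable_traj x t)).aestronglyMeasurable ‖u‖
    (ae_of_all _ fun _ => abs_extendZero_le_norm u _)

theorem integral_extendZero_traj (u : C₀(EuclideanSpace ℝ (Fin d), ℝ)) :
    ∫ q, extendZero u (𝕏.traj q) ∂(𝕏.timeMeasure x t) =
      ∫ s in Set.Ioc (0 : ℝ) t, 𝕏.semigroup s.toNNReal u x := by
  simp only [semigroup_apply]
  exact integral_prod _ (𝕏.integrable_extendZero_traj x t u)

theorem integral_extendZero_X_eq_add {u : C₀(EuclideanSpace ℝ (Fin d), ℝ)}
    (hu : u ∈ 𝕏.generatorDomain) :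
    ∫ ω, extendZero u (𝕏.X t ω) ∂(𝕏.P x) =
      u x + ∫ q, extendZero (𝕏.generator u) (𝕏.traj q) ∂(𝕏.timeMeasure x t) := by
  have hT := 𝕏.isContractionSemigroup_semigroupCLM
  have hcont : Continuous fun s : ℝ => 𝕏.semigroupCLM s.toNNReal (𝕏.generator u) :=
    (hT.continuous_apply _).comp continuous_real_toNNReal
  have hDynkin : ∫ s in (0 : ℝ)..t, evalC₀ x (𝕏.semigroupCLM s.toNNReal (𝕏.generator u)) =
      𝕏.semigroup t u x - u x := by
    rw [ContinuousLinearMap.intervalIntegral_comp_comm _ (hcont.intervalIntegrable _ _),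
      hT.integral_apply_generator (𝕏.hasGenerator_generator hu) t]
    rfl
  rw [intervalIntegral.integral_of_le t.coe_nonneg] at hDynkin
  rw [integral_extendZero_traj, ← semigroup_apply]
  exact eq_add_of_sub_eq' hDynkin.symm

theorem integral_extendZero_X_eq_add_of_tendsto {u : ℕ → C₀(EuclideanSpace ℝ (Fin d), ℝ)}
    (hu : ∀ n, u n ∈ 𝕏.generatorDomain) {p v w : EuclideanSpace ℝ (Fin d) → ℝ} {C : ℝ}
    (hC : 0 ≤ C)
    (hp : ∀ y, Tendsto (fun n => u n y) atTop (𝓝 (p y)))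
    (hv : ∀ y, Tendsto (fun n => 𝕏.generator (u n) y) atTop (𝓝 (v y)))
    (hup : ∀ n y, |u n y| ≤ C * (1 + w y)) (huv : ∀ n y, |𝕏.generator (u n) y| ≤ C * (1 + w y))
    (hwX : Integrable (fun ω => extendZero w (𝕏.X t ω)) (𝕏.P x))
    (hwtraj : Integrable (fun q => extendZero w (𝕏.traj q)) (𝕏.timeMeasure x t)) :
    ∫ ω, extendZero p (𝕏.X t ω) ∂(𝕏.P x) =
      p x + ∫ q, extendZero v (𝕏.traj q) ∂(𝕏.timeMeasure x t) := by
  have hlimX : Tendsto (fun n => ∫ ω, extendZero (u n) (𝕏.X t ω) ∂(𝕏.P x)) atTop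
      (𝓝 (∫ ω, extendZero p (𝕏.X t ω) ∂(𝕏.P x))) :=
    tendsto_integral_of_dominated_convergence _
      (fun n => (𝕏.integrable_extendZero (u n) t x).aestronglyMeasurable)
      (((integrable_const 1).add hwX).const_mul C)
      (fun n => ae_of_all _ fun _ => abs_extendZero_le hC (hup n) _)
      (ae_of_all _ fun _ => tendsto_extendZero hp _)
  have hlimtraj : Tendsto (fun n => ∫ q, extendZero (𝕏.generator (u n)) (𝕏.traj q)
      ∂(𝕏.timeMeasure x t)) atTop (𝓝 (∫ q, extendZero v (𝕏.traj q) ∂(𝕏.timeMeasure x t))) :=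
    tendsto_integral_of_dominated_convergence _
      (fun n => (𝕏.integrable_extendZero_traj x t (𝕏.generator (u n))).aestronglyMeasurable)
      (((integrable_const 1).add hwtraj).const_mul C)
      (fun n => ae_of_all _ fun _ => abs_extendZero_le hC (huv n) _)
      (ae_of_all _ fun _ => tendsto_extendZero hv _)
  exact tendsto_nhds_unique hlimX (((hp x).add hlimtraj).congr fun n =>
    (𝕏.integral_extendZero_X_eq_add x t (hu n)).symm)

theorem abs_semigroup_apply_le {u v : C₀(EuclideanSpace ℝ (Fin d), ℝ)} {C : ℝ} (hC : 0 ≤ C)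
    (h : ∀ y, |v y| ≤ C * (1 + u y)) : |𝕏.semigroup t v x| ≤ C * (1 + 𝕏.semigroup t u x) := by
  have hu := 𝕏.integrable_extendZero u t x
  have hmono := norm_integral_le_of_norm_le (f := fun ω => extendZero v (𝕏.X t ω))
    (((integrable_const 1).add hu).const_mul C) (ae_of_all _ fun _ => abs_extendZero_le hC h _)
  have hbound : ∫ ω, C * (1 + extendZero u (𝕏.X t ω)) ∂(𝕏.P x) =
      C * (1 + ∫ ω, extendZero u (𝕏.X t ω) ∂(𝕏.P x)) := by
    rw [integral_const_mul, integral_add (integrable_const 1) hu, integral_const, probReal_univ,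
      one_smul]
  rw [semigroup_apply, semigroup_apply, ← hbound]
  exact hmono

theorem abs_semigroup_apply_le_gronwallBound {u : C₀(EuclideanSpace ℝ (Fin d), ℝ)}
    (hu : u ∈ 𝕏.generatorDomain) {δ C : ℝ} (hδ : |u x| ≤ δ) (hC : 0 ≤ C)
    (h : ∀ y, |𝕏.generator u y| ≤ C * (1 + u y)) :
    |𝕏.semigroup t u x| ≤ gronwallBound δ C C t := by
  have hT := 𝕏.isContractionSemigroup_semigroupCLM
  have hcont : Continuous fun r : ℝ => evalC₀ x (𝕏.semigroupCLM r.toNNReal u) :=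
    (evalC₀ x).continuous.comp ((hT.continuous_apply u).comp continuous_real_toNNReal)
  have hderiv : ∀ r ∈ Set.Ico (0 : ℝ) t, HasDerivWithinAt
      (fun r : ℝ => evalC₀ x (𝕏.semigroupCLM r.toNNReal u))
      (evalC₀ x (𝕏.semigroupCLM r.toNNReal (𝕏.generator u))) (Set.Ici r) r := fun r hr =>
    (evalC₀ x).hasFDerivAt.comp_hasDerivWithinAt r
      (hT.hasDerivWithinAt_apply (𝕏.hasGenerator_generator hu) hr.1)
  have hstart : ‖evalC₀ x (𝕏.semigroupCLM (0 : ℝ).toNNReal u)‖ ≤ δ := by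
    rw [Real.toNNReal_zero, hT.zero_apply]
    exact hδ
  have hbound : ∀ r ∈ Set.Ico (0 : ℝ) t, ‖evalC₀ x (𝕏.semigroupCLM r.toNNReal (𝕏.generator u))‖ ≤
      C * ‖evalC₀ x (𝕏.semigroupCLM r.toNNReal u)‖ + C := fun r _ => by
    refine (𝕏.abs_semigroup_apply_le x r.toNNReal hC h).trans ?_
    rw [mul_one_add, add_comm]
    gcongr
    exact le_abs_self _
  have hgronwall := norm_le_gronwallBound_of_norm_deriv_right_le hcont.continuousOn hderiv hstart
    hbound t ⟨t.coe_nonneg, le_rfl⟩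
  rwa [sub_zero, Real.toNNReal_coe] at hgronwall

theorem integral_intervalIntegral_eq_integral_timeMeasure {f : ℝ × Ω → ℝ}
    (hf : Integrable f (𝕏.timeMeasure x t)) :
    ∫ ω, (∫ s in (0 : ℝ)..t, f (s, ω)) ∂(𝕏.P x) = ∫ q, f q ∂(𝕏.timeMeasure x t) := by
  simp only [intervalIntegral.integral_of_le t.coe_nonneg]
  exact (integral_prod_symm f hf).symm

end FellerProcess

section Fatou

theorem integrable_of_tendsto_of_integral_norm_le {α F : Type*} [MeasurableSpace α]
    {μ : Measure α} [NormedAddCommGroup F] {f : ℕ → α → F} {g : α → F} {B : ℝ}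
    (hf : ∀ n, Integrable (f n) μ) (hB : ∀ n, ∫ a, ‖f n a‖ ∂μ ≤ B)
    (hlim : ∀ᵐ a ∂μ, Tendsto (fun n => f n a) atTop (𝓝 (g a))) : Integrable g μ := by
  refine memLp_one_iff_integrable.1 ⟨aestronglyMeasurable_of_tendsto_ae atTop
    (fun n => (hf n).aestronglyMeasurable) hlim, ?_⟩
  have hnorm : ∀ n, eLpNorm (f n) 1 μ ≤ ENNReal.ofReal B := fun n => by
    rw [eLpNorm_one_eq_lintegral_enorm, ← ofReal_integral_norm_eq_lintegral_enorm (hf n)]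
    exact ENNReal.ofReal_le_ofReal (hB n)
  exact (Lp.eLpNorm_lim_le_liminf_eLpNorm (fun n => (hf n).aestronglyMeasurable) g hlim).trans_lt
    ((liminf_le_of_frequently_le' (Frequently.of_forall hnorm)).trans_lt ENNReal.ofReal_lt_top)

theorem ae_prod_mem_of_ae_ae_mem {α β γ : Type*} [MeasurableSpace α] [MeasurableSpace β]
    [MeasurableSpace γ] {μ : Measure α} {ν : Measure β} [SFinite ν] {f : α × β → γ}
    (hf : AEMeasurable f (μ.prod ν)) {s : Set γ} (hs : MeasurableSet s)
    (h : ∀ᵐ a ∂μ, ∀ᵐ b ∂ν, f (a, b) ∈ s) : ∀ᵐ q ∂(μ.prod ν), f q ∈ s := by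
  have hmk : ∀ᵐ q ∂(μ.prod ν), hf.mk f q ∈ s := by
    refine (Measure.ae_prod_iff_ae_ae (hf.measurable_mk hs)).2 ?_
    filter_upwards [h, Measure.ae_ae_of_ae_prod hf.ae_eq_mk] with a hmem heq
    filter_upwards [hmem, heq] with b hb hab
    rwa [← hab]
  filter_upwards [hmk, hf.ae_eq_mk] with q hq hfq
  rwa [hfq]

end Fatou

section TruncatedPowersC₀

variable {E : Type*} [NormedAddCommGroup E] [NormedSpace ℝ E] [FiniteDimensional ℝ E]

/-- The truncated power `truncPow ℓ k x₀ n` as an element of `C₀(E, ℝ)`. -/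
def truncPowC₀ (ℓ : E →L[ℝ] ℝ) (k : ℕ) (x₀ : E) (n : ℕ) : C₀(E, ℝ) where
  toFun := truncPow ℓ k x₀ n
  continuous_toFun := (contDiff_truncPow ℓ k x₀ n (m := 0)).continuous
  zero_at_infty' := (hasCompactSupport_truncPow ℓ k x₀ n).is_zero_at_infty

theorem coe_truncPowC₀ (ℓ : E →L[ℝ] ℝ) (k : ℕ) (x₀ : E) (n : ℕ) :
    (truncPowC₀ ℓ k x₀ n : E → ℝ) = truncPow ℓ k x₀ n := rfl

end TruncatedPowersC₀

namespace IsPureJump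

variable {d : ℕ} {Ω : Type*} [MeasurableSpace Ω] {𝕏 : FellerProcess d Ω}
  {N : EuclideanSpace ℝ (Fin d) → Measure (EuclideanSpace ℝ (Fin d))} (hN : IsPureJump 𝕏 N)
include hN

theorem integrable_norm_sq (x : EuclideanSpace ℝ (Fin d)) :
    Integrable (fun z => ‖z‖ ^ 2) ((N x).restrict {0}ᶜ) := by
  refine ⟨by fun_prop, ?_⟩
  simp only [HasFiniteIntegral, enorm_pow, enorm_norm]
  exact (le_iSup (fun x => ∫⁻ z in {0}ᶜ, ‖z‖ₑ ^ 2 ∂(N x)) x).trans_lt hN.second_moment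

theorem exists_integral_norm_sq_le : ∃ M, 0 ≤ M ∧ ∀ x, ∫ z in {0}ᶜ, ‖z‖ ^ 2 ∂(N x) ≤ M := by
  refine ⟨(⨆ x, ∫⁻ z in {0}ᶜ, ‖z‖ₑ ^ 2 ∂(N x)).toReal, ENNReal.toReal_nonneg, fun x => ?_⟩
  rw [integral_eq_lintegral_of_nonneg_ae (ae_of_all _ fun _ => sq_nonneg _)
    (hN.integrable_norm_sq x).aestronglyMeasurable]
  refine ENNReal.toReal_mono hN.second_moment.ne (le_trans (le_of_eq ?_)
    (le_iSup (fun x => ∫⁻ z in {0}ᶜ, ‖z‖ₑ ^ 2 ∂(N x)) x))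
  exact lintegral_congr fun z => by
    rw [ENNReal.ofReal_pow (norm_nonneg z), ofReal_norm]

variable (ℓ : EuclideanSpace ℝ (Fin d) →L[ℝ] ℝ)

theorem truncPowC₀_mem_generatorDomain (k : ℕ) (x₀ : EuclideanSpace ℝ (Fin d)) (n : ℕ) :
    truncPowC₀ ℓ k x₀ n ∈ 𝕏.generatorDomain :=
  hN.smooth_mem_domain _ (contDiff_truncPow ℓ k x₀ n) (hasCompactSupport_truncPow ℓ k x₀ n)

theorem generator_truncPowC₀ (k : ℕ) (x₀ : EuclideanSpace ℝ (Fin d)) (n : ℕ)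
    (x : EuclideanSpace ℝ (Fin d)) :
    𝕏.generator (truncPowC₀ ℓ k x₀ n) x =
      ∫ z in {0}ᶜ, jumpIntegrand (truncPow ℓ k x₀ n) x z ∂(N x) := by
  rw [hN.generator_eq (truncPowC₀ ℓ k x₀ n) (contDiff_truncPow ℓ k x₀ n)
    (hasCompactSupport_truncPow ℓ k x₀ n), jumpOperator_eq_integral_jumpIntegrand, coe_truncPowC₀]

theorem exists_abs_generator_truncPowC₀_le {k : ℕ} (hk : k ≤ 2) :
    ∃ C, 0 ≤ C ∧ ∀ x₀ n x,
      |𝕏.generator (truncPowC₀ ℓ k x₀ n) x| ≤ C * (1 + |truncPow ℓ k x₀ n x|) := by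
  obtain ⟨M, hM0, hM⟩ := hN.exists_integral_norm_sq_le
  obtain ⟨K, hK0, hK⟩ := exists_abs_taylorRemainder_truncPow_le ℓ hk
  obtain ⟨G, hG0, hG⟩ := exists_norm_fderiv_truncPow_le_one_add ℓ hk
  refine ⟨(K + G) * M, by positivity, fun x₀ n x => ?_⟩
  set b := 1 + |truncPow ℓ k x₀ n x|
  have hb1 : 1 ≤ b := le_add_of_nonneg_right (abs_nonneg _)
  calc |𝕏.generator (truncPowC₀ ℓ k x₀ n) x|
      ≤ (K + ‖fderiv ℝ (truncPow ℓ k x₀ n) x‖) * ∫ z in {0}ᶜ, ‖z‖ ^ 2 ∂(N x) := by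
        rw [hN.generator_truncPowC₀]
        exact abs_integral_jumpIntegrand_le (hN.integrable_norm_sq x) (hK x₀ n x)
    _ ≤ (K * b + G * b) * M := by
        gcongr
        exacts [le_mul_of_one_le_right hK0 hb1, hG x₀ n x, hM x]
    _ = (K + G) * M * b := by ring

theorem tendsto_generator_truncPowC₀ {k : ℕ} (hk : k ≤ 2) (x₀ x : EuclideanSpace ℝ (Fin d)) :
    Tendsto (fun n => 𝕏.generator (truncPowC₀ ℓ k x₀ n) x) atTop
      (𝓝 (jumpOperator N (centeredPow ℓ k x₀) x)) := by
  obtain ⟨K, -, hK⟩ := exists_abs_taylorRemainder_truncPow_le ℓ hk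
  simp only [hN.generator_truncPowC₀, jumpOperator_eq_integral_jumpIntegrand]
  exact tendsto_integral_jumpIntegrand (hN.integrable_norm_sq x)
    (fun n => (truncPowC₀ ℓ k x₀ n).continuous) (fun n => hK x₀ n x)
    (eventually_truncPow_eventuallyEq ℓ k x₀ x) (tendsto_truncPow ℓ k x₀)

theorem measurable_jumpOperator_centeredPow {k : ℕ} (hk : k ≤ 2)
    (x₀ : EuclideanSpace ℝ (Fin d)) :
    Measurable (jumpOperator N (centeredPow ℓ k x₀)) :=
  measurable_of_tendsto_metrizable
    (fun n => (𝕏.generator (truncPowC₀ ℓ k x₀ n)).continuous.measurable)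
    (tendsto_pi_nhds.2 (hN.tendsto_generator_truncPowC₀ ℓ hk x₀))

theorem measurable_integral_one_le_norm :
    Measurable fun x => ∫ z in {z | 1 ≤ ‖z‖}, ℓ z ∂(N x) := by
  have h := hN.measurable_jumpOperator_centeredPow ℓ one_le_two 0
  simpa only [funext fun x => jumpOperator_centeredPow_one (N := N) (x := x) ℓ 0] using h

theorem measurable_integral_sq : Measurable fun x => ∫ z in {0}ᶜ, ℓ z ^ 2 ∂(N x) := by
  have hmean := hN.measurable_integral_one_le_norm ℓ
  have hsq := (hN.measurable_jumpOperator_centeredPow ℓ le_rfl 0).sub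
    ((ℓ.continuous.measurable.mul hmean).const_mul 2)
  convert hsq using 2 with x
  simp [jumpOperator_centeredPow_two ℓ 0 (hN.integrable_norm_sq x)]

theorem exists_abs_integral_one_le_norm_le :
    ∃ M, ∀ x, |∫ z in {z | 1 ≤ ‖z‖}, ℓ z ∂(N x)| ≤ M := by
  obtain ⟨M, -, hM⟩ := hN.exists_integral_norm_sq_le
  refine ⟨‖ℓ‖ * M, fun x => ?_⟩
  rw [setIntegral_one_le_norm_eq]
  exact (abs_integral_indicator_one_le_norm_le (hN.integrable_norm_sq x) ℓ).trans
    (mul_le_mul_of_nonneg_left (hM x) (norm_nonneg ℓ))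

theorem exists_abs_integral_sq_le : ∃ M, ∀ x, |∫ z in {0}ᶜ, ℓ z ^ 2 ∂(N x)| ≤ M := by
  obtain ⟨M, -, hM⟩ := hN.exists_integral_norm_sq_le
  exact ⟨‖ℓ‖ ^ 2 * M, fun x => (abs_integral_sq_apply_le (hN.integrable_norm_sq x) ℓ).trans
    (mul_le_mul_of_nonneg_left (hM x) (sq_nonneg _))⟩

variable (x₀ x : EuclideanSpace ℝ (Fin d)) (t : ℝ≥0)

theorem exists_abs_semigroup_truncPowC₀_two_le :
    ∃ B, ∀ s ≤ t, ∀ n, |𝕏.semigroup s (truncPowC₀ ℓ 2 x₀ n) x| ≤ B := by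
  obtain ⟨C, hC0, hC⟩ := hN.exists_abs_generator_truncPowC₀_le ℓ le_rfl
  refine ⟨gronwallBound |centeredPow ℓ 2 x₀ x| C C t, fun s hs n => ?_⟩
  refine (𝕏.abs_semigroup_apply_le_gronwallBound x s (hN.truncPowC₀_mem_generatorDomain ℓ 2 x₀ n)
    (abs_truncPow_le ℓ 2 x₀ n x) hC0 fun y => ?_).trans
    (gronwallBound_mono (abs_nonneg _) hC0 hC0 hs)
  have h := hC x₀ n y
  rwa [abs_of_nonneg (truncPow_nonneg ℓ x₀ n even_two y)] at h

theorem integrable_centeredPow_two_X :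
    Integrable (fun ω => extendZero (centeredPow ℓ 2 x₀) (𝕏.X t ω)) (𝕏.P x) := by
  obtain ⟨B, hB⟩ := hN.exists_abs_semigroup_truncPowC₀_two_le ℓ x₀ x t
  refine integrable_of_tendsto_of_integral_norm_le
    (fun n => 𝕏.integrable_extendZero (truncPowC₀ ℓ 2 x₀ n) t x) (B := B) (fun n => ?_)
    (ae_of_all _ fun ω => tendsto_extendZero (tendsto_truncPow ℓ 2 x₀) _)
  have hnonneg : ∀ y, 0 ≤ truncPowC₀ ℓ 2 x₀ n y := truncPow_nonneg ℓ x₀ n even_two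
  simp only [Real.norm_of_nonneg (extendZero_nonneg hnonneg _)]
  rw [← 𝕏.semigroup_apply]
  exact (le_abs_self _).trans (hB t le_rfl n)

theorem integrable_centeredPow_two_traj :
    Integrable (fun q => extendZero (centeredPow ℓ 2 x₀) (𝕏.traj q)) (𝕏.timeMeasure x t) := by
  obtain ⟨B, hB⟩ := hN.exists_abs_semigroup_truncPowC₀_two_le ℓ x₀ x t
  refine integrable_of_tendsto_of_integral_norm_le
    (fun n => 𝕏.integrable_extendZero_traj x t (truncPowC₀ ℓ 2 x₀ n))
    (B := B * volume.real (Set.Ioc (0 : ℝ) t)) (fun n => ?_)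
    (ae_of_all _ fun q => tendsto_extendZero (tendsto_truncPow ℓ 2 x₀) _)
  have hnonneg : ∀ y, 0 ≤ truncPowC₀ ℓ 2 x₀ n y := truncPow_nonneg ℓ x₀ n even_two
  simp only [Real.norm_of_nonneg (extendZero_nonneg hnonneg _)]
  rw [𝕏.integral_extendZero_traj]
  have hbound := norm_setIntegral_le_of_norm_le_const (μ := volume)
    (f := fun s : ℝ => 𝕏.semigroup s.toNNReal (truncPowC₀ ℓ 2 x₀ n) x)
    (measure_Ioc_lt_top (a := 0)) fun s hs => hB _ (Real.toNNReal_le_iff_le_coe.2 hs.2) n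
  exact (le_abs_self _).trans hbound

theorem integral_centeredPow_X_eq_add {k : ℕ} (hk : k ≤ 2) :
    ∫ ω, extendZero (centeredPow ℓ k x₀) (𝕏.X t ω) ∂(𝕏.P x) = centeredPow ℓ k x₀ x +
      ∫ q, extendZero (jumpOperator N (centeredPow ℓ k x₀)) (𝕏.traj q)
        ∂(𝕏.timeMeasure x t) := by
  obtain ⟨C, hC0, hC⟩ := hN.exists_abs_generator_truncPowC₀_le ℓ hk
  have htrunc : ∀ n y, |truncPow ℓ k x₀ n y| ≤ 1 + centeredPow ℓ 2 x₀ y := fun n y =>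
    (abs_truncPow_le ℓ k x₀ n y).trans (abs_centeredPow_le_one_add ℓ hk x₀ y)
  have hsq : ∀ y, 0 ≤ centeredPow ℓ 2 x₀ y := fun y => sq_nonneg _
  refine 𝕏.integral_extendZero_X_eq_add_of_tendsto x t (C := 1 + 2 * C)
    (hN.truncPowC₀_mem_generatorDomain ℓ k x₀) (by positivity) (tendsto_truncPow ℓ k x₀)
    (hN.tendsto_generator_truncPowC₀ ℓ hk x₀) (fun n y => ?_) (fun n y => ?_)
    (hN.integrable_centeredPow_two_X ℓ x₀ x t) (hN.integrable_centeredPow_two_traj ℓ x₀ x t)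
  · exact (htrunc n y).trans (le_mul_of_one_le_left (by linarith [hsq y]) (by linarith))
  · refine (hC x₀ n y).trans ?_
    nlinarith [mul_le_mul_of_nonneg_left (htrunc n y) hC0, mul_nonneg hC0 (hsq y), hsq y]

theorem ae_X_ne_infty : ∀ᵐ ω ∂(𝕏.P x), 𝕏.X t ω ≠ OnePoint.infty := by
  have hmeas : MeasurableSet {ω | 𝕏.X t ω ≠ OnePoint.infty} :=
    𝕏.measurable_X t (measurableSet_singleton _).compl
  have hindicator : ∀ ω, extendZero (centeredPow 0 0 0) (𝕏.X t ω) =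
      Set.indicator {ω | 𝕏.X t ω ≠ OnePoint.infty} (1 : Ω → ℝ) ω := fun ω => by
    by_cases hω : 𝕏.X t ω = OnePoint.infty
    · simp [hω]
    · simp [hω, extendZero_eq_of_ne_infty, centeredPow]
  have hDynkin := hN.integral_centeredPow_X_eq_add 0 0 x t zero_le_two
  have hzero : ∀ q, extendZero (jumpOperator N (centeredPow 0 0 0)) (𝕏.traj q) = 0 := fun q => by
    induction 𝕏.traj q using OnePoint.rec with
    | infty => rfl
    | coe y => exact jumpOperator_centeredPow_zero 0 0
  simp only [hindicator, hzero, integral_zero, add_zero, integral_indicator_one hmeas,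
    centeredPow, pow_zero] at hDynkin
  rw [measureReal_def, ENNReal.toReal_eq_one_iff] at hDynkin
  exact (mem_ae_iff_prob_eq_one hmeas).2 hDynkin

theorem ae_traj_ne_infty : ∀ᵐ q ∂(𝕏.timeMeasure x t), 𝕏.traj q ≠ OnePoint.infty :=
  ae_prod_mem_of_ae_ae_mem (𝕏.aemeasurable_traj x t) (measurableSet_singleton _).compl
    (ae_of_all _ fun s => hN.ae_X_ne_infty x s.toNNReal)

theorem integral_centeredPow_position_X_eq_add {k : ℕ} (hk : k ≤ 2) :
    ∫ ω, centeredPow ℓ k x₀ (position (𝕏.X t ω)) ∂(𝕏.P x) = centeredPow ℓ k x₀ x +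
      ∫ q, jumpOperator N (centeredPow ℓ k x₀) (position (𝕏.traj q)) ∂(𝕏.timeMeasure x t) := by
  rw [← integral_congr_ae ((hN.ae_X_ne_infty x t).mono fun ω hω => extendZero_eq_of_ne_infty _ hω),
    hN.integral_centeredPow_X_eq_add ℓ x₀ x t hk,
    integral_congr_ae ((hN.ae_traj_ne_infty x t).mono fun q hq => extendZero_eq_of_ne_infty _ hq)]

theorem memLp_apply_position_X : MemLp (fun ω => ℓ (position (𝕏.X t ω))) 2 (𝕏.P x) := by
  have hmeas : Measurable fun ω => ℓ (position (𝕏.X t ω)) :=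
    ℓ.continuous.measurable.comp (measurable_position.comp (𝕏.measurable_X t))
  refine (memLp_two_iff_integrable_sq hmeas.aestronglyMeasurable).2
    ((hN.integrable_centeredPow_two_X ℓ 0 x t).congr ?_)
  filter_upwards [hN.ae_X_ne_infty x t] with ω hω
  rw [extendZero_eq_of_ne_infty _ hω, centeredPow, sub_zero]

theorem memLp_apply_position_traj :
    MemLp (fun q => ℓ (position (𝕏.traj q))) 2 (𝕏.timeMeasure x t) := by
  have hmeas : AEMeasurable (fun q => ℓ (position (𝕏.traj q))) (𝕏.timeMeasure x t) :=
    (ℓ.continuous.measurable.comp measurable_position).comp_aemeasurable (𝕏.aemeasurable_traj x t)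
  refine (memLp_two_iff_integrable_sq hmeas.aestronglyMeasurable).2
    ((hN.integrable_centeredPow_two_traj ℓ 0 x t).congr ?_)
  filter_upwards [hN.ae_traj_ne_infty x t] with q hq
  rw [extendZero_eq_of_ne_infty _ hq, centeredPow, sub_zero]

theorem integrable_integral_one_le_norm_traj :
    Integrable (fun q => ∫ z in {z | 1 ≤ ‖z‖}, ℓ z ∂(N (position (𝕏.traj q))))
      (𝕏.timeMeasure x t) := by
  obtain ⟨M, hM⟩ := hN.exists_abs_integral_one_le_norm_le ℓ
  exact Integrable.of_bound (((hN.measurable_integral_one_le_norm ℓ).comp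
    measurable_position).comp_aemeasurable (𝕏.aemeasurable_traj x t)).aestronglyMeasurable M
    (ae_of_all _ fun _ => hM _)

theorem integrable_integral_sq_traj :
    Integrable (fun q => ∫ z in {0}ᶜ, ℓ z ^ 2 ∂(N (position (𝕏.traj q)))) (𝕏.timeMeasure x t) := by
  obtain ⟨M, hM⟩ := hN.exists_abs_integral_sq_le ℓ
  exact Integrable.of_bound (((hN.measurable_integral_sq ℓ).comp
    measurable_position).comp_aemeasurable (𝕏.aemeasurable_traj x t)).aestronglyMeasurable M
    (ae_of_all _ fun _ => hM _)

theorem integrable_apply_sub_mul_integral_one_le_norm_traj :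
    Integrable (fun q => (ℓ (position (𝕏.traj q)) - ℓ x₀) *
      ∫ z in {z | 1 ≤ ‖z‖}, ℓ z ∂(N (position (𝕏.traj q)))) (𝕏.timeMeasure x t) := by
  obtain ⟨M, hM⟩ := hN.exists_abs_integral_one_le_norm_le ℓ
  exact (((hN.memLp_apply_position_traj ℓ x t).integrable one_le_two).sub
    (integrable_const (ℓ x₀))).mul_bdd
    (hN.integrable_integral_one_le_norm_traj ℓ x t).aestronglyMeasurable
    (ae_of_all _ fun _ => hM _)

theorem integral_apply_position_X_sub :
    ∫ ω, (ℓ (position (𝕏.X t ω)) - ℓ x) ∂(𝕏.P x) =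
      ∫ q, (∫ z in {z | 1 ≤ ‖z‖}, ℓ z ∂(N (position (𝕏.traj q)))) ∂(𝕏.timeMeasure x t) := by
  simpa only [jumpOperator_centeredPow_one, centeredPow, map_sub, sub_self, map_zero,
    pow_one, zero_add] using hN.integral_centeredPow_position_X_eq_add ℓ x x t one_le_two

theorem integral_apply_position_X_sub_sq :
    ∫ ω, (ℓ (position (𝕏.X t ω)) - ℓ x) ^ 2 ∂(𝕏.P x) =
      ∫ q, (∫ z in {0}ᶜ, ℓ z ^ 2 ∂(N (position (𝕏.traj q)))) ∂(𝕏.timeMeasure x t) +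
      2 * ∫ q, (ℓ (position (𝕏.traj q)) - ℓ x) *
        (∫ z in {z | 1 ≤ ‖z‖}, ℓ z ∂(N (position (𝕏.traj q)))) ∂(𝕏.timeMeasure x t) := by
  rw [← integral_const_mul, ← integral_add (hN.integrable_integral_sq_traj ℓ x t)
    ((hN.integrable_apply_sub_mul_integral_one_le_norm_traj ℓ x x t).const_mul 2)]
  simpa only [jumpOperator_centeredPow_two ℓ x (hN.integrable_norm_sq _), centeredPow, map_sub,
    sub_self, map_zero, zero_pow two_ne_zero, zero_add]
    using hN.integral_centeredPow_position_X_eq_add ℓ x x t le_rfl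

end IsPureJump

end FellerMoment

end

/-- Besides the formulas, the conclusion records what makes every term in them meaningful: `X_t` is
almost surely in `ℝᵈ`, and the integrands of the time integrals are absolutely integrable for
`ds ⊗ ℙ_{x₀}` on `(0, t] × Ω`. -/
theorem mainTheorem2 {d : ℕ} {Ω : Type*} [MeasurableSpace Ω]
    (𝕏 : FellerMoment.FellerProcess d Ω)
    (N : EuclideanSpace ℝ (Fin d) → Measure (EuclideanSpace ℝ (Fin d)))
    (hN : FellerMoment.IsPureJump 𝕏 N)
    (t : ℝ≥0) (ht : 0 < t) (i : Fin d) (x₀ : EuclideanSpace ℝ (Fin d)) :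
    (∀ᵐ ω ∂(𝕏.P x₀), 𝕏.X t ω ≠ OnePoint.infty) ∧
    MemLp (𝕏.coord i t) 2 (𝕏.P x₀) ∧
    Integrable
      (fun p : ℝ × Ω =>
        FellerMoment.jumpSecondMoment N i (FellerMoment.position (𝕏.X p.1.toNNReal p.2)))
      ((volume.restrict (Set.Ioc (0 : ℝ) t)).prod (𝕏.P x₀)) ∧
    Integrable
      (fun p : ℝ × Ω => (𝕏.coord i p.1.toNNReal p.2 - x₀ i) *
        FellerMoment.largeJumpMean N i (FellerMoment.position (𝕏.X p.1.toNNReal p.2)))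
      ((volume.restrict (Set.Ioc (0 : ℝ) t)).prod (𝕏.P x₀)) ∧
    Integrable
      (fun p : ℝ × Ω =>
        FellerMoment.largeJumpMean N i (FellerMoment.position (𝕏.X p.1.toNNReal p.2)))
      ((volume.restrict (Set.Ioc (0 : ℝ) t)).prod (𝕏.P x₀)) ∧
    (∫ ω, (𝕏.coord i t ω - x₀ i) ^ 2 ∂(𝕏.P x₀)) =
      (∫ ω, (∫ s in (0 : ℝ)..t,
        FellerMoment.jumpSecondMoment N i (FellerMoment.position (𝕏.X s.toNNReal ω)))
          ∂(𝕏.P x₀)) +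
      2 * (∫ ω, (∫ s in (0 : ℝ)..t, (𝕏.coord i s.toNNReal ω - x₀ i) *
        FellerMoment.largeJumpMean N i (FellerMoment.position (𝕏.X s.toNNReal ω)))
          ∂(𝕏.P x₀)) ∧
    (∫ ω, (𝕏.coord i t ω - x₀ i) ∂(𝕏.P x₀)) =
      ∫ ω, (∫ s in (0 : ℝ)..t,
        FellerMoment.largeJumpMean N i (FellerMoment.position (𝕏.X s.toNNReal ω)))
          ∂(𝕏.P x₀) := by
  let ℓ : EuclideanSpace ℝ (Fin d) →L[ℝ] ℝ := EuclideanSpace.proj i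
  have hJ := hN.integrable_integral_sq_traj ℓ x₀ t
  have hXL := hN.integrable_apply_sub_mul_integral_one_le_norm_traj ℓ x₀ x₀ t
  have hL := hN.integrable_integral_one_le_norm_traj ℓ x₀ t
  refine ⟨hN.ae_X_ne_infty x₀ t, hN.memLp_apply_position_X ℓ x₀ t, hJ, hXL, hL, ?_, ?_⟩
  · refine (hN.integral_apply_position_X_sub_sq ℓ x₀ t).trans ?_
    rw [← 𝕏.integral_intervalIntegral_eq_integral_timeMeasure x₀ t hJ,
      ← 𝕏.integral_intervalIntegral_eq_integral_timeMeasure x₀ t hXL]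
    rfl
  · exact (hN.integral_apply_position_X_sub ℓ x₀ t).trans
      (𝕏.integral_intervalIntegral_eq_integral_timeMeasure x₀ t hL).symm
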